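/- For $n\ge 1$ let $S_n$ be the group of permutations of $[n]=\{1,\dots,n\}$, and for $\pi\in S_n$ let $D(\pi)=\{i\in[n-1] : \pi(i)>\pi(i+1)\}$ be its descent set. For $I\subseteq[n-1]$ let $\beta_n(I)$ be the number of $\pi\in S_n$ with $D(\pi)=I$, and let $\beta^{\mathrm{cyc}}_n(I)$ be the number of $n$-cycles $\pi\in S_n$ (permutations whose cycle type is $(n)$) with $D(\pi)=I$. Then for each $n\ge 1$ there is a non-empty collection $\mathcal{I}_n$ of subsets of $[n-1]$ such that $$|\mathcal{I}_n|\sim 2^{n-1}\quad (n\to\infty)\qquad\text{and}\qquad \lim_{n\to\infty}\ \max_{I\in\mathcal{I}_n}\left|\frac{n\,\beta^{\mathrm{cyc}}_n(I)}{\beta_n(I)}-1\right|=0 .$$ -/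

import Mathlib

open Filter Topology Asymptotics

namespace CyclicDescent

/-- The descent set of a permutation of `{1, …, n}`, as a subset of `{1, …, n - 1}`.  The elements
`1, …, n` are represented by `0, …, n - 1 : Fin n`, so the positions `i` and `i + 1` are the elements
of `Fin n` with values `i - 1` and `i`. -/
def descentSet {n : ℕ} (π : Equiv.Perm (Fin n)) : Finset ℕ :=
  {i ∈ Finset.Icc 1 (n - 1) | ∃ a b : Fin n, a.val + 1 = i ∧ b.val = i ∧ π b < π a}

/-- `π` is an `n`-cycle: its cycle type, a partition of `n` (fixed points count as parts equal
to `1`), is `(n)`. -/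
def IsNCycle {n : ℕ} (π : Equiv.Perm (Fin n)) : Prop :=
  π.partition.parts = {n}

instance {n : ℕ} : DecidablePred (IsNCycle (n := n)) :=
  fun π => inferInstanceAs (Decidable (π.partition.parts = {n}))

/-- The number of permutations in `S_n` with descent set `I`. -/
def beta (n : ℕ) (I : Finset ℕ) : ℕ :=
  Finset.card {π : Equiv.Perm (Fin n) | descentSet π = I}

/-- The number of `n`-cycles in `S_n` with descent set `I`. -/
def betaCyc (n : ℕ) (I : Finset ℕ) : ℕ :=
  Finset.card {π : Equiv.Perm (Fin n) | IsNCycle π ∧ descentSet π = I}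

end CyclicDescent

/-! Fix the `n`-cycle `c = finRotate n`; each `n`-cycle is `τ * c * τ⁻¹` for exactly `n`
permutations `τ`, so `n * betaCyc n I` counts these `τ` by descent set (`mul_betaCyc`). For descent
set contained in `J`, cut the positions into blocks at `J` and let `b` be the word of block indices.
Permutations with descents in `J` correspond to all rearrangements of `b`. In the style of Gessel
and Reutenauer, the `τ` correspond to the primitive rearrangements, those whose cyclic shifts are
distinct. The two counts thus differ by at most the number of nonprimitive words, about `n ^ (n /
2)` up to a factor `n` (`card_descentSet_subset_diff`). Inclusion–exclusion passes to descent set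
exactly `I` at the cost of `2 ^ n`. This error is negligible once `beta n I` is large: if ascent and
descent runs are shorter than `L`, then `beta n I ≥ n! / (2 * L) ^ n` (`ShortRuns.factorial_le`).
With `L` of order `log n` the relative error is at most `(24 * L / √n) ^ n`, and a union bound shows
that almost all `I` have such short runs. -/

namespace CyclicDescent

/-! ### Permutations and rearrangements of words -/

section Words

variable {n : ℕ} {α : Type*} [LinearOrder α]

/-- `π` is increasing on every fibre of `b`. -/
def IncreasingOnFibers (b : Fin n → α) (π : Equiv.Perm (Fin n)) : Prop :=
  ∀ i j, i < j → b i = b j → π i < π j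

/-- The infinite word read off from `f` along the orbit of `i` under `c`. -/
def orbitWord (c : Equiv.Perm (Fin n)) (f : Fin n → α) (i : Fin n) : Lex (ℕ → α) :=
  toLex fun t => f ((c ^ t) i)

theorem orbitWord_lt_iff {c : Equiv.Perm (Fin n)} {f : Fin n → α} {i j : Fin n} :
    orbitWord c f i < orbitWord c f j ↔
      ∃ t, (∀ s < t, f ((c ^ s) i) = f ((c ^ s) j)) ∧ f ((c ^ t) i) < f ((c ^ t) j) :=
  Iff.rfl

theorem apply_le_of_orbitWord_lt {c : Equiv.Perm (Fin n)} {f : Fin n → α} {i j : Fin n}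
    (h : orbitWord c f i < orbitWord c f j) : f i ≤ f j := by
  obtain ⟨t, h1, h2⟩ := orbitWord_lt_iff.1 h
  rcases Nat.eq_zero_or_pos t with rfl | ht
  · simpa using h2.le
  · simpa using (h1 0 ht).le

theorem orbitWord_apply_lt {c : Equiv.Perm (Fin n)} {f : Fin n → α} {i j : Fin n}
    (h : orbitWord c f i < orbitWord c f j) (hf : f i = f j) :
    orbitWord c f (c i) < orbitWord c f (c j) := by
  obtain ⟨t, h1, h2⟩ := orbitWord_lt_iff.1 h
  rcases t with _ | t
  · simp [hf] at h2
  · refine orbitWord_lt_iff.2 ⟨t, fun s hs => ?_, ?_⟩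
    · simpa [pow_succ] using h1 (s + 1) (by omega)
    · simpa [pow_succ] using h2

/-- Permutations increasing on the fibres of `b` correspond to the rearrangements of `b`. -/
theorem bijOn_increasing_words {b : Fin n → α} (hb : Monotone b) :
    Set.BijOn (fun π : Equiv.Perm (Fin n) => b ∘ ⇑π⁻¹) {π | IncreasingOnFibers b π}
      (Set.range fun σ : Equiv.Perm (Fin n) => b ∘ σ) := by
  have key : ∀ π, IncreasingOnFibers b π → π = Tuple.sort (b ∘ ⇑π⁻¹) := by
    intro π hπ
    rw [Tuple.eq_sort_iff]
    have : (b ∘ ⇑π⁻¹) ∘ ⇑π = b := by ext; simp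
    refine ⟨by rwa [this], fun i j hij h => hπ i j hij ?_⟩
    simpa using h
  refine ⟨fun π _ => ⟨π⁻¹, rfl⟩, fun π hπ τ hτ h => ?_, ?_⟩
  · rw [key π hπ, key τ hτ]
    exact congrArg _ h
  · rintro f ⟨σ, rfl⟩
    set s := Tuple.sort (b ∘ σ)
    have hs := Tuple.monotone_sort (b ∘ σ)
    have h2 : (b ∘ σ) ∘ ⇑s = b := by
      have := Tuple.unique_monotone (f := b ∘ σ) (σ := s) (τ := σ⁻¹) hs
        (by rwa [show (b ∘ σ) ∘ ⇑σ⁻¹ = b by ext; simp])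
      rw [this]; ext; simp
    refine ⟨s, fun i j hij h => ?_, ?_⟩
    · refine ((Tuple.eq_sort_iff (f := b ∘ σ) (σ := s)).1 rfl).2 i j hij ?_
      have := congrFun h2
      simp only [Function.comp_apply] at this ⊢
      rw [this, this, h]
    · ext x
      have := congrFun h2 (s⁻¹ x)
      simpa using this.symm

/-- While the words from `x < y` agree, `π` preserves the order of the two orbits, so the first
differing letters are ordered correctly because `b` is monotone. Transitivity of `c` excludes
agreement forever. -/
theorem strictMono_orbitWord {b : Fin n → α} (hb : Monotone b) {c : Equiv.Perm (Fin n)}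
    (hc : ∀ x y, ∃ s : ℕ, (c ^ s) y = x) {τ : Equiv.Perm (Fin n)}
    (h : IncreasingOnFibers b (τ * c * τ⁻¹)) :
    StrictMono (orbitWord c (b ∘ τ) ∘ ⇑τ⁻¹) := by
  intro x y hxy
  set π := τ * c * τ⁻¹ with hπ
  have hpow : ∀ t z, τ ((c ^ t) (τ⁻¹ z)) = (π ^ t) z := by
    intro t z
    rw [hπ, conj_pow]; simp
  have step : ∀ t, (∀ s < t, b ((π ^ s) x) = b ((π ^ s) y)) → (π ^ t) x < (π ^ t) y := by
    intro t
    induction t with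
    | zero => intro _; simpa using hxy
    | succ t ih =>
      intro ht
      have := h _ _ (ih fun s hs => ht s (by omega)) (ht t (by omega))
      simpa [pow_succ'] using this
  by_cases hall : ∀ t, b ((π ^ t) x) = b ((π ^ t) y)
  · exfalso
    obtain ⟨s, hs⟩ := hc (τ⁻¹ x) (τ⁻¹ y)
    have hs' : (π ^ s) y = x := by rw [← hpow, hs]; simp
    -- Since `(π ^ s) y = x < y` and all powers of `π` preserve this inequality, iterating `π ^ s`
    -- from `y` descends forever in `Fin n`.
    have hanti : StrictAnti fun m : ℕ => (π ^ (s * m)) y := by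
      refine strictAnti_nat_of_succ_lt fun m => ?_
      have := step (s * m) fun u _ => hall u
      rw [← hs', ← Equiv.Perm.mul_apply, ← pow_add] at this
      simpa [mul_add] using this
    exact not_strictAnti_of_wellFoundedLT _ hanti
  · push Not at hall
    classical
    refine orbitWord_lt_iff.2 ⟨Nat.find hall, fun s hs => ?_, ?_⟩
    · have := Nat.find_min hall hs
      simp only [Function.comp_apply, hpow]
      simpa using this
    · have h1 := step (Nat.find hall) fun s hs => by simpa using Nat.find_min hall hs
      have h2 := lt_of_le_of_ne (hb h1.le) (Nat.find_spec hall)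
      simp only [Function.comp_apply, hpow]
      exact h2

/-- Conjugates of the transitive permutation `c` increasing on the fibres of `b`, together with
the conjugating permutation, correspond to the primitive rearrangements of `b`. -/
theorem bijOn_increasing_primitive_words {b : Fin n → α} (hb : Monotone b)
    {c : Equiv.Perm (Fin n)} (hc : ∀ x y, ∃ s : ℕ, (c ^ s) y = x) :
    Set.BijOn (fun τ : Equiv.Perm (Fin n) => b ∘ τ)
      {τ | IncreasingOnFibers b (τ * c * τ⁻¹)}
      {f | (∃ σ : Equiv.Perm (Fin n), b ∘ σ = f) ∧ Function.Injective (orbitWord c f)} := by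
  -- Injectivity: the word recovers `τ`, as `τ⁻¹` must sort the positions by their orbit words.
  have key : ∀ τ : Equiv.Perm (Fin n), IncreasingOnFibers b (τ * c * τ⁻¹) →
      τ⁻¹ = Tuple.sort (orbitWord c (b ∘ τ)) := by
    intro τ hτ
    have hs := strictMono_orbitWord hb hc hτ
    rw [Tuple.eq_sort_iff]
    exact ⟨hs.monotone, fun i j hij h => absurd h (hs hij).ne⟩
  refine ⟨fun τ hτ => ⟨⟨τ, rfl⟩, ?_⟩, fun τ hτ τ' hτ' h => ?_, ?_⟩
  · have hs := (strictMono_orbitWord hb hc hτ).injective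
    exact (τ⁻¹.injective_comp _).1 hs
  · have h1 := key τ hτ
    have h2 := key τ' hτ'
    have h3 : b ∘ τ = b ∘ τ' := h
    rw [h3, ← h2] at h1
    exact inv_injective h1
  · rintro f ⟨⟨σ, rfl⟩, hinj⟩
    set s := Tuple.sort (orbitWord c (b ∘ σ))
    have hs : StrictMono (orbitWord c (b ∘ σ) ∘ s) :=
      (Tuple.monotone_sort _).strictMono_of_injective (hinj.comp s.injective)
    have h2 : (b ∘ σ) ∘ ⇑s = b := by
      have := Tuple.unique_monotone (f := b ∘ σ) (σ := s) (τ := σ⁻¹)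
        (monotone_iff_forall_lt.2 fun x y hxy =>
          show (b ∘ σ) (s x) ≤ (b ∘ σ) (s y) from apply_le_of_orbitWord_lt (hs hxy))
        (by rwa [show (b ∘ σ) ∘ ⇑σ⁻¹ = b by ext; simp])
      rw [this]; ext; simp
    refine ⟨s⁻¹, fun i j hij h => ?_, ?_⟩
    · have h3 := congrFun h2
      have h4 : (b ∘ σ) (s i) = (b ∘ σ) (s j) := by
        have hi := h3 i
        have hj := h3 j
        simp only [Function.comp_apply] at hi hj ⊢
        rw [hi, hj, h]
      have h5 := orbitWord_apply_lt (hs hij) h4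
      have h6 : ∀ k, s ((s⁻¹ * c * s⁻¹⁻¹) k) = c (s k) := fun k => by simp
      refine hs.lt_iff_lt.1 ?_
      simp only [Function.comp_apply, h6]
      exact h5
    · ext x
      have := congrFun h2 (s⁻¹ x)
      simpa using this.symm

end Words

/-! ### Descent sets contained in `J` as a condition on blocks -/

section Blocks

variable {n : ℕ}

/-- The index of the block containing `x` when `{0, …, n - 1}` is cut before each element of `J`. -/
def blockIndex (J : Finset ℕ) (x : ℕ) : ℕ := (J.filter (· ≤ x)).card

theorem blockIndex_mono (J : Finset ℕ) : Monotone (blockIndex J) := fun _ _ h =>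
  Finset.card_le_card (Finset.monotone_filter_right _ fun _ _ hj => hj.trans h)

theorem blockIndex_succ_of_notMem {J : Finset ℕ} {x : ℕ} (h : x + 1 ∉ J) :
    blockIndex J (x + 1) = blockIndex J x := by
  unfold blockIndex
  congr 1
  ext j
  simp only [Finset.mem_filter, and_congr_right_iff]
  intro hj
  have : j ≠ x + 1 := fun e => h (e ▸ hj)
  omega

theorem blockIndex_lt_succ_of_mem {J : Finset ℕ} {x : ℕ} (h : x + 1 ∈ J) :
    blockIndex J x < blockIndex J (x + 1) := by
  refine Finset.card_lt_card ⟨Finset.monotone_filter_right _ fun _ _ hj => hj.trans (by omega), ?_⟩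
  intro hsub
  have := hsub (Finset.mem_filter.2 ⟨h, le_rfl⟩)
  simp at this

theorem blockIndex_lt {J : Finset ℕ} (hn : 0 < n) (hJ : J ⊆ Finset.Icc 1 (n - 1)) (x : ℕ) :
    blockIndex J x < n := by
  have := (Finset.card_filter_le J (· ≤ x)).trans (Finset.card_le_card hJ)
  rw [Nat.card_Icc] at this
  unfold blockIndex
  omega

/-- `blockIndex` as a word of length `n` in the alphabet `Fin n`. -/
def blockWord {J : Finset ℕ} (hJ : J ⊆ Finset.Icc 1 (n - 1)) (x : Fin n) : Fin n :=
  ⟨blockIndex J x, blockIndex_lt x.pos hJ x⟩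

theorem blockWord_mono {J : Finset ℕ} (hJ : J ⊆ Finset.Icc 1 (n - 1)) :
    Monotone (blockWord hJ) := fun _ _ h => blockIndex_mono J h

theorem descentSet_subset_Icc (π : Equiv.Perm (Fin n)) :
    descentSet π ⊆ Finset.Icc 1 (n - 1) := Finset.filter_subset _ _

theorem mem_descentSet {π : Equiv.Perm (Fin n)} {x : ℕ} (hx : x + 1 < n) :
    x + 1 ∈ descentSet π ↔ π ⟨x + 1, hx⟩ < π ⟨x, by omega⟩ := by
  simp only [descentSet, Finset.mem_filter, Finset.mem_Icc]
  constructor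
  · rintro ⟨-, a, b, ha, hb, h⟩
    have ha' : a = ⟨x, by omega⟩ := Fin.ext (by simpa using ha)
    have hb' : b = ⟨x + 1, hx⟩ := Fin.ext hb
    exact hb' ▸ ha' ▸ h
  · exact fun h => ⟨by omega, _, _, rfl, rfl, h⟩

theorem descentSet_subset_iff {J : Finset ℕ} (hJ : J ⊆ Finset.Icc 1 (n - 1))
    (π : Equiv.Perm (Fin n)) :
    descentSet π ⊆ J ↔ IncreasingOnFibers (blockWord hJ) π := by
  constructor
  · intro h
    have key : ∀ d i : ℕ, ∀ hd : i + d + 1 < n, blockIndex J i = blockIndex J (i + d + 1) →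
        π ⟨i, by omega⟩ < π ⟨i + d + 1, hd⟩ := by
      intro d
      have step : ∀ j (hj : j + 1 < n), blockIndex J j = blockIndex J (j + 1) →
          π ⟨j, by omega⟩ < π ⟨j + 1, hj⟩ := by
        intro j hj hb
        have h1 : j + 1 ∉ descentSet π := fun h1 => (blockIndex_lt_succ_of_mem (h h1)).ne hb
        rw [mem_descentSet hj, not_lt] at h1
        exact lt_of_le_of_ne h1 fun e => by simpa using π.injective e
      induction d with
      | zero => exact fun i hd hb => step i hd hb
      | succ d ih =>
        intro i hd hb
        have h1 := blockIndex_mono J (show i ≤ i + d + 1 by omega)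
        have h2 := blockIndex_mono J (show i + d + 1 ≤ i + (d + 1) + 1 by omega)
        refine (ih i (by omega) (by omega)).trans (step (i + d + 1) hd ?_)
        rw [← add_assoc] at hb h2
        omega
    intro i j hij hb
    have hij' : i.val < j.val := hij
    have hj : i.val + (j.val - i.val - 1) + 1 = j.val := by omega
    have := key (j.val - i.val - 1) i.val (by omega) (by rw [hj]; exact congrArg Fin.val hb)
    simpa only [hj] using this
  · intro h x hx
    have hx' := Finset.mem_Icc.1 (descentSet_subset_Icc π hx)
    obtain ⟨y, rfl⟩ : ∃ y, x = y + 1 := ⟨x - 1, by omega⟩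
    by_contra hJx
    rw [mem_descentSet (by omega)] at hx
    refine lt_asymm hx (h _ _ (by simp [Fin.lt_def]) ?_)
    exact Fin.ext (blockIndex_succ_of_notMem hJx).symm

end Blocks

/-! ### Counting `n`-cycles through conjugators -/

section Cycles

open scoped Fin.CommRing

variable {m : ℕ}

theorem finRotate_pow_apply (t : ℕ) (i : Fin (m + 1)) :
    (finRotate (m + 1) ^ t) i = i + (t : Fin (m + 1)) := by
  induction t with
  | zero => simp
  | succ t ih => rw [pow_succ', Equiv.Perm.mul_apply, ih, finRotate_apply]; push_cast; ring

theorem exists_finRotate_pow_apply_eq (x y : Fin (m + 1)) :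
    ∃ s : ℕ, (finRotate (m + 1) ^ s) y = x :=
  ⟨(x - y).val, by rw [finRotate_pow_apply]; simp⟩

theorem isNCycle_iff_isConj (π : Equiv.Perm (Fin (m + 2))) :
    IsNCycle π ↔ IsConj (finRotate (m + 2)) π := by
  rw [Equiv.Perm.partition_eq_of_isConj, IsNCycle, Nat.Partition.ext_iff,
    Equiv.Perm.parts_partition (σ := finRotate (m + 2)), cycleType_finRotate, support_finRotate]
  simp [eq_comm]

theorem card_centralizer_finRotate :
    Nat.card (Subgroup.centralizer {finRotate (m + 2)}) = m + 2 := by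
  rw [Equiv.Perm.nat_card_centralizer, cycleType_finRotate]
  simp

/-- The conjugators form a coset of the centralizer of the rotation, which has order `m + 2`. -/
theorem card_conjugators {π : Equiv.Perm (Fin (m + 2))} (h : IsNCycle π) :
    Finset.card {τ : Equiv.Perm (Fin (m + 2)) | τ * finRotate (m + 2) * τ⁻¹ = π} = m + 2 := by
  obtain ⟨g, rfl⟩ := isConj_iff.1 ((isNCycle_iff_isConj π).1 h)
  refine Eq.trans ?_ (card_centralizer_finRotate (m := m))
  rw [← Fintype.card_subtype, ← Nat.card_eq_fintype_card]
  refine Nat.card_congr (Equiv.subtypeEquiv (Equiv.mulLeft g⁻¹) fun τ => ?_)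
  rw [Subgroup.mem_centralizer_singleton_iff, Equiv.coe_mulLeft]
  constructor
  · intro h
    calc g⁻¹ * τ * finRotate (m + 2) = g⁻¹ * (τ * finRotate (m + 2) * τ⁻¹) * τ := by group
      _ = _ := by rw [h]; group
  · intro h
    calc τ * finRotate (m + 2) * τ⁻¹ = g * (g⁻¹ * τ * finRotate (m + 2)) * τ⁻¹ := by group
      _ = _ := by rw [h]; group

theorem mul_betaCyc (I : Finset ℕ) :
    (m + 2) * betaCyc (m + 2) I = Finset.card
      {τ : Equiv.Perm (Fin (m + 2)) | descentSet (τ * finRotate (m + 2) * τ⁻¹) = I} := by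
  rw [betaCyc, mul_comm, eq_comm]
  rw [Finset.card_eq_sum_card_fiberwise (f := fun τ => τ * finRotate (m + 2) * τ⁻¹)
    (t := {π : Equiv.Perm (Fin (m + 2)) | IsNCycle π ∧ descentSet π = I})]
  · refine Finset.sum_const_nat fun π hπ => ?_
    refine Eq.trans ?_ (card_conjugators (Finset.mem_filter.1 hπ).2.1)
    rw [Finset.filter_filter]
    congr 1
    ext τ
    simp only [Finset.mem_filter, Finset.mem_univ, true_and, and_iff_right_iff_imp]
    rintro rfl
    exact (Finset.mem_filter.1 hπ).2.2
  · intro τ hτ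
    simp only [Finset.coe_filter, Finset.mem_univ, true_and, Set.mem_ofPred_eq] at hτ ⊢
    exact ⟨(isNCycle_iff_isConj _).2 (isConj_iff.2 ⟨τ, rfl⟩), hτ⟩

end Cycles

/-! ### Nonprimitive words are rare -/

section Nonprimitive

open scoped Fin.CommRing

variable {m : ℕ}

theorem eq_of_periodic {α : Type*} {f g : Fin (m + 2) → α} {p : Fin (m + 2)} (hp : p ≠ 0)
    (hp' : p.val ≤ (m + 2) / 2) (hf : ∀ x, f (x + p) = f x) (hg : ∀ x, g (x + p) = g x)
    (h : ∀ x : Fin (m + 2), x.val < (m + 2) / 2 → f x = g x) : f = g := by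
  have key : ∀ k : ℕ, ∀ x : Fin (m + 2), x.val = k → f x = g x := by
    intro k
    induction k using Nat.strong_induction_on with
    | _ k ih =>
      intro x hx
      by_cases hk : x.val < (m + 2) / 2
      · exact h x hk
      · have hp0 : 0 < p.val := Nat.pos_of_ne_zero fun e => hp (Fin.ext e)
        have hle : p ≤ x := Fin.le_def.2 (by omega)
        have h1 : (x - p).val = x.val - p.val := Fin.sub_val_of_le hle
        have := ih (x - p).val (by omega) (x - p) rfl
        rw [← hf (x - p), ← hg (x - p)] at this
        simpa using this
  exact funext fun x => key _ x rfl

/-- Equal orbit words at `i` and `j` make `f` periodic modulo `m + 2` with period `j - i`, and also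
with period `i - j`; one of the two is at most half the length. -/
theorem exists_period {α : Type*} [LinearOrder α] {f : Fin (m + 2) → α}
    (h : ¬ Function.Injective (orbitWord (finRotate (m + 2)) f)) :
    ∃ p : Fin (m + 2), p ≠ 0 ∧ p.val ≤ (m + 2) / 2 ∧ ∀ x, f (x + p) = f x := by
  simp only [Function.Injective, not_forall] at h
  obtain ⟨i, j, hij, hne⟩ := h
  have h1 : ∀ x, f (x + (j - i)) = f x := by
    intro x
    have := congrFun hij ((x - i).val)
    simp only [orbitWord, Pi.toLex_apply, finRotate_pow_apply, Fin.cast_val_eq_self] at this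
    rw [show x + (j - i) = j + (x - i) by ring, ← this]
    congr 1; ring
  have h2 : ∀ x, f (x + (i - j)) = f x := by
    intro x
    rw [← h1 (x + (i - j))]
    congr 1; ring
  by_cases hle : (j - i).val ≤ (m + 2) / 2
  · exact ⟨j - i, sub_ne_zero.2 (Ne.symm hne), hle, h1⟩
  · refine ⟨i - j, sub_ne_zero.2 hne, ?_, h2⟩
    have : i - j = -(j - i) := by ring
    rw [this, Fin.val_neg']
    have h3 : (m + 2 - (j - i).val) % (m + 2) = m + 2 - (j - i).val :=
      Nat.mod_eq_of_lt (by omega)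
    omega

/-- Union bound over the period `p`: a word with period at most half its length is determined by its
first half. -/
theorem card_nonprimitive_le (α : Type*) [LinearOrder α] [Fintype α] :
    {f : Fin (m + 2) → α | ¬ Function.Injective (orbitWord (finRotate (m + 2)) f)}.ncard ≤
      (m + 2) * Fintype.card α ^ ((m + 2) / 2) := by
  classical
  set P : Fin (m + 2) → Finset (Fin (m + 2) → α) := fun p =>
    if p ≠ 0 ∧ p.val ≤ (m + 2) / 2 then Finset.univ.filter fun f => ∀ x, f (x + p) = f x else ∅ with hP
  have hcard : ∀ p ∈ Finset.univ, (P p).card ≤ Fintype.card α ^ ((m + 2) / 2) := by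
    intro p _
    by_cases hp : p ≠ 0 ∧ p.val ≤ (m + 2) / 2
    · have : Fintype.card α ^ ((m + 2) / 2) =
          (Finset.univ : Finset (Fin ((m + 2) / 2) → α)).card := by simp
      rw [this]
      refine Finset.card_le_card_of_injOn
        (fun f i => f ⟨i.val, by omega⟩) (fun _ _ => Finset.mem_coe.2 (Finset.mem_univ _)) ?_
      intro f hf g hg hfg
      simp only [hP, if_pos hp, Finset.coe_filter, Finset.mem_univ, true_and] at hf hg
      exact eq_of_periodic hp.1 hp.2 hf hg fun x hx => congrFun hfg ⟨x.val, hx⟩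
    · simp only [hP, if_neg hp, Finset.card_empty, zero_le]
  have hsub : {f : Fin (m + 2) → α | ¬ Function.Injective (orbitWord (finRotate (m + 2)) f)} ⊆
      (Finset.univ.biUnion P : Finset _) := by
    intro f hf
    obtain ⟨p, hp, hp', hfp⟩ := exists_period hf
    simp only [Finset.coe_biUnion, Set.mem_iUnion]
    exact ⟨p, Finset.mem_coe.2 (Finset.mem_univ p), by
      simpa only [hP, if_pos (And.intro hp hp'), Finset.coe_filter, Finset.mem_univ, true_and,
        Set.mem_ofPred_eq] using hfp⟩
  refine (Set.ncard_le_ncard hsub (Finset.finite_toSet _)).trans ?_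
  rw [Set.ncard_coe_finset]
  refine (Finset.card_biUnion_le_card_mul _ _ _ hcard).trans ?_
  simp

/-- The conjugates of an `n`-cycle with descents in `J` are almost as numerous as the
permutations with descents in `J`. -/
theorem card_descentSet_subset_diff {J : Finset ℕ} (hJ : J ⊆ Finset.Icc 1 (m + 2 - 1)) :
    |(Finset.card {τ : Equiv.Perm (Fin (m + 2)) |
          descentSet (τ * finRotate (m + 2) * τ⁻¹) ⊆ J} : ℤ) -
        Finset.card {π : Equiv.Perm (Fin (m + 2)) | descentSet π ⊆ J}| ≤
      (m + 2) * (m + 2) ^ ((m + 2) / 2) := by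
  have hA := (bijOn_increasing_words (blockWord_mono hJ))
  have hB := (bijOn_increasing_primitive_words (blockWord_mono hJ)
    (exists_finRotate_pow_apply_eq (m := m + 1)))
  simp only [← descentSet_subset_iff] at hA hB
  have hA' := hA.ncard_eq
  have hB' := hB.ncard_eq
  set W := Set.range fun σ : Equiv.Perm (Fin (m + 2)) => blockWord hJ ∘ σ
  set N := {f : Fin (m + 2) → Fin (m + 2) |
    ¬ Function.Injective (orbitWord (finRotate (m + 2)) f)}
  have hN := card_nonprimitive_le (m := m) (Fin (m + 2))
  rw [Fintype.card_fin] at hN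
  set P := {f | (∃ σ : Equiv.Perm (Fin (m + 2)), blockWord hJ ∘ σ = f) ∧
    Function.Injective (orbitWord (finRotate (m + 2)) f)}
  have h1 : P.ncard ≤ W.ncard := Set.ncard_le_ncard (fun f hf => hf.1) (Set.toFinite _)
  have h2 : W.ncard ≤ P.ncard + N.ncard := by
    refine (Set.ncard_le_ncard (fun f hf => ?_) (Set.toFinite _)).trans (Set.ncard_union_le P N)
    by_cases h : Function.Injective (orbitWord (finRotate (m + 2)) f)
    · exact Or.inl ⟨hf, h⟩
    · exact Or.inr h
  rw [← Set.ncard_coe_finset, ← Set.ncard_coe_finset, Finset.coe_filter, Finset.coe_filter]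
  simp only [Finset.mem_univ, true_and]
  rw [hA', hB', abs_le]
  have h3 : (N.ncard : ℤ) ≤ (m + 2) * (m + 2) ^ ((m + 2) / 2) := by exact_mod_cast hN
  constructor <;> omega

end Nonprimitive

/-! ### From descent set inside `J` to descent set equal to `I` -/

section InclusionExclusion

/-- If two finite families of sets are equidistributed up to `M` on down-sets, then they are
equidistributed up to `2 ^ #I * M` at `I`. -/
theorem abs_card_eq_sub_card_eq_le {ι : Type*} [Fintype ι] (D D' : ι → Finset ℕ) {M : ℤ}
    {U : Finset ℕ}
    (h : ∀ J ⊆ U, |(Finset.card {x | D x ⊆ J} : ℤ) - Finset.card {x | D' x ⊆ J}| ≤ M)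
    {I : Finset ℕ} (hI : I ⊆ U) :
    |(Finset.card {x | D x = I} : ℤ) - Finset.card {x | D' x = I}| ≤ 2 ^ I.card * M := by
  classical
  have split : ∀ (E : ι → Finset ℕ) (a : ℕ) (A B : Finset ℕ),
      (Finset.card {x | insert a A ⊆ E x ∧ E x ⊆ B} : ℤ) =
        Finset.card {x | A ⊆ E x ∧ E x ⊆ B} - Finset.card {x | A ⊆ E x ∧ E x ⊆ B.erase a} := by
    intro E a A B
    rw [eq_sub_iff_add_eq, ← Nat.cast_add, ← Finset.card_union_of_disjoint]
    · congr 2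
      ext x
      simp only [Finset.mem_union, Finset.mem_filter, Finset.mem_univ, true_and,
        Finset.insert_subset_iff, Finset.subset_erase]
      tauto
    · refine Finset.disjoint_filter.2 fun x _ h1 h2 => ?_
      exact Finset.notMem_erase a B (h2.2 (h1.1 (Finset.mem_insert_self a A)))
  -- Each element required in the lower bound `A` writes a count as a difference of two, by `split`,
  -- which doubles the error.
  have key : ∀ A B : Finset ℕ, B ⊆ U →
      |(Finset.card {x | A ⊆ D x ∧ D x ⊆ B} : ℤ) - Finset.card {x | A ⊆ D' x ∧ D' x ⊆ B}| ≤
        2 ^ A.card * M := by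
    intro A
    induction A using Finset.induction_on with
    | empty => intro B hB; simpa using h B hB
    | insert a A ha ih =>
      intro B hB
      have h1 := abs_le.1 (ih B hB)
      have h2 := abs_le.1 (ih (B.erase a) ((Finset.erase_subset a B).trans hB))
      rw [split D, split D', Finset.card_insert_of_notMem ha, pow_succ, abs_le]
      constructor <;> linarith
  have := key I I hI
  simpa only [← Finset.Subset.antisymm_iff, eq_comm (a := I)] using this

theorem abs_mul_betaCyc_sub_beta_le {m : ℕ} {I : Finset ℕ} (hI : I ⊆ Finset.Icc 1 (m + 2 - 1)) :
    |(((m + 2) * betaCyc (m + 2) I : ℕ) : ℤ) - beta (m + 2) I| ≤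
      2 ^ (m + 2) * ((m + 2) * (m + 2) ^ ((m + 2) / 2)) := by
  rw [mul_betaCyc, beta]
  refine (abs_card_eq_sub_card_eq_le (fun τ => descentSet (τ * finRotate (m + 2) * τ⁻¹))
    descentSet (fun J hJ => card_descentSet_subset_diff hJ) hI).trans ?_
  have : I.card ≤ m + 2 := (Finset.card_le_card hI).trans (by simp)
  gcongr
  norm_num

end InclusionExclusion

/-! ### Lower bound for `beta` when runs are short -/

section LowerBound

/-- Group the `n!` permutations `σ` by the word `h ∘ σ`, of which there are at most `k ^ n`.
Composing `σ⁻¹` with the inverse of a sort of that word injects each group into the level-respecting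
permutations. -/
theorem factorial_le_of_levels {n k : ℕ} (h : Fin n → Fin k) (S : Finset (Equiv.Perm (Fin n)))
    (hS : ∀ π : Equiv.Perm (Fin n), (∀ i j, h i < h j → π i < π j) → π ∈ S) :
    n.factorial ≤ k ^ n * S.card := by
  classical
  have h1 := Finset.card_le_mul_card_image (f := fun σ : Equiv.Perm (Fin n) => h ∘ σ)
    Finset.univ S.card ?_
  · rw [Finset.card_univ, Fintype.card_perm, Fintype.card_fin] at h1
    refine h1.trans ?_
    rw [mul_comm]
    gcongr
    exact (Finset.card_le_univ _).trans (by simp)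
  · intro g _
    refine Finset.card_le_card_of_injOn (fun σ => (Tuple.sort g)⁻¹ * σ⁻¹) ?_ ?_
    · intro σ hσ
      have hσ' : h ∘ σ = g := by simpa using hσ
      refine hS _ fun i j hij => ?_
      by_contra! hle
      have := Tuple.monotone_sort g hle
      simp [← hσ'] at this
      exact absurd hij this.not_gt
    · intro σ _ τ _ hστ
      simpa using hστ

/-- A function of `i` which increases at the ascents prescribed by `I` and decreases at the
descents. -/
def height (I : Finset ℕ) : ℕ → ℤ
  | 0 => 0
  | i + 1 => if i + 1 ∈ I then min (height I i) 0 - 1 else max (height I i) 0 + 1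

theorem height_succ_lt_iff {I : Finset ℕ} {i : ℕ} :
    height I (i + 1) < height I i ↔ i + 1 ∈ I := by
  rw [height]
  split_ifs with h
  · simp only [h, iff_true]
    omega
  · simp only [h, iff_false]
    omega

theorem height_lt_succ_iff {I : Finset ℕ} {i : ℕ} :
    height I i < height I (i + 1) ↔ i + 1 ∉ I := by
  rw [height]
  split_ifs with h
  · simp only [h, not_true, iff_false]
    omega
  · simp only [h, not_false_eq_true, iff_true]
    omega

/-- The reset to `0` at each change of direction means that height `k` at `i` is reached only after
`k` consecutive ascents ending there. -/
theorem notMem_of_le_height {I : Finset ℕ} {k i : ℕ} (h : (k : ℤ) ≤ height I i) :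
    k ≤ i ∧ ∀ j, i < j + k → j ≤ i → j ∉ I := by
  induction i generalizing k with
  | zero =>
    rw [height] at h
    exact ⟨by omega, fun j h1 h2 => by omega⟩
  | succ i ih =>
    rw [height] at h
    split_ifs at h with hi
    · omega
    · rcases le_or_gt k 1 with hk | hk
      · refine ⟨by omega, fun j h1 h2 => ?_⟩
        rwa [show j = i + 1 by omega]
      · obtain ⟨h1, h2⟩ := ih (k := k - 1) (by omega)
        refine ⟨by omega, fun j h3 h4 => ?_⟩
        rcases Nat.lt_or_ge i j with hj | hj
        · rwa [show j = i + 1 by omega]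
        · exact h2 j (by omega) hj

theorem mem_of_le_neg_height {I : Finset ℕ} {k i : ℕ} (h : (k : ℤ) ≤ -height I i) :
    k ≤ i ∧ ∀ j, i < j + k → j ≤ i → j ∈ I := by
  induction i generalizing k with
  | zero =>
    rw [height] at h
    exact ⟨by omega, fun j h1 h2 => by omega⟩
  | succ i ih =>
    rw [height] at h
    split_ifs at h with hi
    · rcases le_or_gt k 1 with hk | hk
      · refine ⟨by omega, fun j h1 h2 => ?_⟩
        rwa [show j = i + 1 by omega]
      · obtain ⟨h1, h2⟩ := ih (k := k - 1) (by omega)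
        refine ⟨by omega, fun j h3 h4 => ?_⟩
        rcases Nat.lt_or_ge i j with hj | hj
        · rwa [show j = i + 1 by omega]
        · exact h2 j (by omega) hj
    · omega

/-- Neither `I` nor its complement contains `L` consecutive elements of `{1, …, n - 1}`. -/
def ShortRuns (n L : ℕ) (I : Finset ℕ) : Prop :=
  ∀ s < n - L, ¬ Finset.Ioc s (s + L) ⊆ I ∧ ¬ Disjoint (Finset.Ioc s (s + L)) I

theorem ShortRuns.abs_height_lt {n L : ℕ} {I : Finset ℕ} (hI : ShortRuns n L I) {i : ℕ}
    (hi : i < n) : |height I i| < L := by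
  by_contra! h
  rcases le_abs.1 h with h | h
  · obtain ⟨h1, h2⟩ := notMem_of_le_height h
    refine (hI (i - L) (by omega)).2 (Finset.disjoint_left.2 fun j hj => ?_)
    rw [Finset.mem_Ioc] at hj
    exact h2 j (by omega) (by omega)
  · obtain ⟨h1, h2⟩ := mem_of_le_neg_height h
    refine (hI (i - L) (by omega)).1 fun j hj => ?_
    rw [Finset.mem_Ioc] at hj
    exact h2 j (by omega) (by omega)

/-- Heights lie strictly between `-L` and `L`, giving at most `2 * L` levels. Adjacent positions
have different heights, so respecting the levels forces the descent set to be `I`. -/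
theorem ShortRuns.factorial_le {n L : ℕ} {I : Finset ℕ} (hI : ShortRuns n L I)
    (hIn : I ⊆ Finset.Icc 1 (n - 1)) : n.factorial ≤ (2 * L) ^ n * beta n I := by
  have hlt : ∀ x : Fin n, (height I x + L).toNat < 2 * L := fun x => by
    have := abs_lt.1 (hI.abs_height_lt x.isLt)
    omega
  refine factorial_le_of_levels (fun x => ⟨(height I x + L).toNat, hlt x⟩) _ fun π hπ => ?_
  have hπ' : ∀ i j : Fin n, height I i < height I j → π i < π j := fun i j hij =>
    hπ i j (Fin.lt_def.2 (by
      have := abs_lt.1 (hI.abs_height_lt i.isLt)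
      show (height I i + L).toNat < (height I j + L).toNat
      omega))
  rw [Finset.mem_filter]
  refine ⟨Finset.mem_univ _, Finset.ext fun x => ?_⟩
  by_cases hx : x ∈ Finset.Icc 1 (n - 1)
  · rw [Finset.mem_Icc] at hx
    obtain ⟨y, rfl⟩ : ∃ y, x = y + 1 := ⟨x - 1, by omega⟩
    rw [mem_descentSet (by omega)]
    constructor
    · intro h
      by_contra hy
      exact lt_asymm h (hπ' _ _ (height_lt_succ_iff.2 hy))
    · exact fun h => hπ' _ _ (height_succ_lt_iff.2 h)
  · exact ⟨fun h => absurd (descentSet_subset_Icc π h) hx, fun h => absurd (hIn h) hx⟩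

end LowerBound

/-! ### Most sets have short runs -/

section Counting

-- Union bound over windows of length `L`: containing the window or missing it each fixes `L` of the
-- `n - 1` membership choices.
open scoped Classical in
theorem card_not_shortRuns_le (n L : ℕ) :
    ((Finset.Icc 1 (n - 1)).powerset.filter fun I => ¬ ShortRuns n L I).card ≤
      (n - L) * (2 * 2 ^ (n - 1 - L)) := by
  set U := Finset.Icc 1 (n - 1)
  have hsub : (U.powerset.filter fun I => ¬ ShortRuns n L I) ⊆
      (Finset.range (n - L)).biUnion fun s =>
        Finset.Icc (Finset.Ioc s (s + L)) U ∪ (U \ Finset.Ioc s (s + L)).powerset := by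
    intro I hI
    rw [Finset.mem_filter, Finset.mem_powerset] at hI
    simp only [ShortRuns, not_forall] at hI
    obtain ⟨hIU, s, hs, h⟩ := hI
    rw [Finset.mem_biUnion]
    refine ⟨s, Finset.mem_range.2 hs, ?_⟩
    rw [Finset.mem_union, Finset.mem_Icc, Finset.mem_powerset, Finset.subset_sdiff]
    by_cases h1 : Finset.Ioc s (s + L) ⊆ I
    · exact Or.inl ⟨h1, hIU⟩
    · exact Or.inr ⟨hIU, (not_not.1 fun h2 => h ⟨h1, h2⟩).symm⟩
  refine (Finset.card_le_card hsub).trans (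
    (Finset.card_biUnion_le_card_mul _ _ (2 * 2 ^ (n - 1 - L)) ?_).trans ?_)
  · intro s hs
    rw [Finset.mem_range] at hs
    have hW : Finset.Ioc s (s + L) ⊆ U := fun j hj => by
      rw [Finset.mem_Ioc] at hj
      exact Finset.mem_Icc.2 (by omega)
    refine (Finset.card_union_le _ _).trans ?_
    rw [Finset.card_Icc_finset hW, Finset.card_powerset, Finset.card_sdiff_of_subset hW]
    simp [U, two_mul]
  · rw [Finset.card_range]

end Counting

/-! ### Choice of the run length and asymptotics -/

section Asymptotic

/-- The threshold for short runs: twice the number of binary digits of `n`. -/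
def runBound (n : ℕ) : ℕ := 2 * (Nat.log 2 n + 1)

/-- This size makes the union bound `2 * n / 2 ^ L` on the exceptional proportion at most `2 / n`.
-/
theorem sq_le_two_pow_runBound (n : ℕ) : n ^ 2 ≤ 2 ^ runBound n := by
  rw [runBound, mul_comm, pow_mul]
  exact Nat.pow_le_pow_left (Nat.lt_pow_succ_log_self one_lt_two n).le 2

/-- The relative error bound for sets with short runs. -/
noncomputable def runError (n : ℕ) : ℝ := 24 * runBound n / √n

theorem runError_nonneg (n : ℕ) : 0 ≤ runError n := by unfold runError; positivity

theorem tendsto_runError : Tendsto runError atTop (𝓝 0) := by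
  have h1 : Tendsto (fun n : ℕ => Real.log n / (n : ℝ) ^ (1 / 2 : ℝ)) atTop (𝓝 0) :=
    (isLittleO_log_rpow_atTop (by norm_num)).tendsto_div_nhds_zero.comp
      tendsto_natCast_atTop_atTop
  have h2 : Tendsto (fun n : ℕ => ((n : ℝ) ^ (1 / 2 : ℝ))⁻¹) atTop (𝓝 0) :=
    ((tendsto_rpow_atTop (by norm_num)).comp tendsto_natCast_atTop_atTop).inv_tendsto_atTop
  have h3 := (h1.const_mul 96).add (h2.const_mul 48)
  simp only [mul_zero, add_zero] at h3
  refine squeeze_zero runError_nonneg (fun n => ?_) h3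
  rw [runError, Real.sqrt_eq_rpow, ← mul_div_assoc, ← div_eq_mul_inv, ← add_div]
  gcongr
  rw [runBound]
  push_cast
  have h4 : (Nat.log 2 n : ℝ) ≤ 2 * Real.log n := by
    refine (Real.natLog_le_logb n 2).trans ?_
    rw [Nat.cast_ofNat, Real.logb, div_le_iff₀ (Real.log_pos one_lt_two)]
    have h5 : 0 ≤ Real.log n := Real.log_natCast_nonneg n
    nlinarith [Real.log_two_gt_d9]
  linarith

theorem abs_ratio_sub_one_le {n : ℕ} (hn : 2 ≤ n) {I : Finset ℕ} (hI : I ⊆ Finset.Icc 1 (n - 1))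
    (hr : ShortRuns n (runBound n) I) :
    |(n : ℝ) * betaCyc n I / beta n I - 1| ≤ runError n ^ n := by
  obtain ⟨m, rfl⟩ : ∃ m, n = m + 2 := ⟨n - 2, by omega⟩
  have h1 := abs_mul_betaCyc_sub_beta_le hI
  have h2 := hr.factorial_le hI
  set n := m + 2
  set L := runBound n
  have h1' : |(n : ℝ) * betaCyc n I - beta n I| ≤ 2 ^ n * (n * n ^ (n / 2)) := by
    exact_mod_cast h1
  have h2' : (n.factorial : ℝ) ≤ (2 * L) ^ n * beta n I := by exact_mod_cast h2
  have hfac : (0 : ℝ) < n.factorial := by positivity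
  have hn0 : (0 : ℝ) < n := by positivity
  -- The lower bound also rules out division by zero in the ratio.
  have hb : (0 : ℝ) < beta n I := by
    by_contra! hb
    have : (beta n I : ℝ) = 0 := le_antisymm hb (Nat.cast_nonneg _)
    rw [this, mul_zero] at h2'
    linarith
  have h3 : (n : ℝ) ^ n ≤ 3 ^ n * n.factorial := by
    have := Real.pow_div_factorial_le_exp n hn0.le n
    rw [div_le_iff₀ hfac] at this
    refine this.trans ?_
    rw [← mul_one (n : ℝ), Real.exp_nat_mul]
    gcongr
    exact Real.exp_one_lt_three.le
  have h4 : (n : ℝ) ≤ 2 ^ n := by exact_mod_cast Nat.lt_two_pow_self.le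
  have hs : √(n : ℝ) * √n = n := Real.mul_self_sqrt hn0.le
  have hs0 : 0 < √(n : ℝ) := Real.sqrt_pos.2 hn0
  have hs1 : 1 ≤ √(n : ℝ) := Real.one_le_sqrt.2 (by exact_mod_cast (by omega : 1 ≤ n))
  have h5 : (n : ℝ) ^ (n / 2) ≤ √n ^ n := by
    calc (n : ℝ) ^ (n / 2) = √n ^ (2 * (n / 2)) := by rw [pow_mul, Real.sq_sqrt hn0.le]
      _ ≤ √n ^ n := pow_le_pow_right₀ hs1 (by omega)
  have h6 : (n : ℝ) ^ n = √n ^ n * √n ^ n := by rw [← mul_pow, hs]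
  have h7 : √(n : ℝ) ^ n * √n ^ n ≤ 3 ^ n * ((2 * L) ^ n * beta n I) := by
    rw [← h6]
    exact h3.trans (by gcongr)
  rw [div_sub_one hb.ne', abs_div, abs_of_pos hb, div_le_iff₀ hb]
  refine h1'.trans ?_
  rw [runError, div_pow, div_mul_eq_mul_div, le_div_iff₀ (by positivity)]
  -- The constant is `24 = 2 * 2 * 3 * 2`: inclusion–exclusion, `n ≤ 2 ^ n`, `n ^ n ≤ 3 ^ n * n!`,
  -- and the `2 * L` levels.
  calc (2 : ℝ) ^ n * (n * n ^ (n / 2)) * √n ^ n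
      ≤ 2 ^ n * (2 ^ n * √n ^ n) * √n ^ n := by gcongr
    _ = 4 ^ n * (√n ^ n * √n ^ n) := by
      rw [show (4 : ℝ) = 2 * 2 by norm_num, mul_pow]; ring
    _ ≤ 4 ^ n * (3 ^ n * ((2 * L) ^ n * beta n I)) := by gcongr
    _ = (24 * L) ^ n * beta n I := by
      rw [show (24 : ℝ) * L = 4 * (3 * (2 * L)) by ring, mul_pow 4, mul_pow 3]; ring

open scoped Classical in
/-- The subsets of `{1, …, n - 1}` with short runs. -/
noncomputable def shortRunSets (n : ℕ) : Finset (Finset ℕ) :=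
  (Finset.Icc 1 (n - 1)).powerset.filter (ShortRuns n (runBound n))

theorem mem_shortRunSets {n : ℕ} {I : Finset ℕ} :
    I ∈ shortRunSets n ↔ I ⊆ Finset.Icc 1 (n - 1) ∧ ShortRuns n (runBound n) I := by
  simp [shortRunSets]

theorem card_shortRunSets_le (n : ℕ) : (shortRunSets n).card ≤ 2 ^ (n - 1) := by
  classical
  refine (Finset.card_filter_le _ _).trans ?_
  simp

theorem le_card_shortRunSets {n : ℕ} (hn : 0 < n) :
    (1 - 2 / n : ℝ) * 2 ^ (n - 1) ≤ (shortRunSets n).card := by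
  classical
  set L := runBound n with hL
  have h1 := Finset.card_filter_add_card_filter_not (s := (Finset.Icc 1 (n - 1)).powerset)
    (ShortRuns n L)
  rw [Finset.card_powerset, Nat.card_Icc, Nat.add_sub_cancel] at h1
  have h2 : (shortRunSets n).card + (n - L) * (2 * 2 ^ (n - 1 - L)) ≥ 2 ^ (n - 1) := by
    have := card_not_shortRuns_le n L
    have h3 : (shortRunSets n).card =
      ((Finset.Icc 1 (n - 1)).powerset.filter (ShortRuns n L)).card := by
      rw [shortRunSets]
    rw [h3, ← h1]
    gcongr
  have hn0 : (0 : ℝ) < n := by exact_mod_cast hn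
  rcases Nat.lt_or_ge (n - 1) L with hlt | hle
  -- No window of length `L` fits, so every subset has short runs.
  · rw [Nat.sub_eq_zero_of_le (by omega : n ≤ L), zero_mul, add_zero] at h2
    have h2' : (2 : ℝ) ^ (n - 1) ≤ (shortRunSets n).card := by exact_mod_cast h2
    refine le_trans ?_ h2'
    have : (0 : ℝ) ≤ 2 / n := by positivity
    exact mul_le_of_le_one_left (by positivity) (by linarith)
  have h2' : (2 : ℝ) ^ (n - 1) ≤ (shortRunSets n).card + n * (2 * 2 ^ (n - 1 - L)) := by
    exact_mod_cast h2.trans (by gcongr; omega)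
  have h4 : (2 : ℝ) ^ (n - 1) = 2 ^ L * 2 ^ (n - 1 - L) := by rw [← pow_add]; congr 1; omega
  have h5 : (n : ℝ) ^ 2 ≤ 2 ^ L := by exact_mod_cast sq_le_two_pow_runBound n
  have h6 : (n : ℝ) * (2 * 2 ^ (n - 1 - L)) ≤ 2 / n * 2 ^ (n - 1) := by
    rw [h4, div_mul_eq_mul_div, le_div_iff₀ hn0]
    have : (0 : ℝ) ≤ 2 ^ (n - 1 - L) := by positivity
    nlinarith
  linarith

theorem tendsto_one_sub_two_div : Tendsto (fun n : ℕ => (1 - 2 / n : ℝ)) atTop (𝓝 1) := by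
  simpa using (tendsto_const_div_atTop_nhds_zero_nat (2 : ℝ)).const_sub 1

theorem isEquivalent_card_shortRunSets :
    (fun n => ((shortRunSets n).card : ℝ)) ~[atTop] fun n => (2 : ℝ) ^ (n - 1) := by
  rw [isEquivalent_iff_tendsto_one (Eventually.of_forall fun n => by positivity)]
  refine tendsto_of_tendsto_of_tendsto_of_le_of_le' tendsto_one_sub_two_div tendsto_const_nhds
    ?_ (Eventually.of_forall fun n => ?_)
  · filter_upwards [eventually_gt_atTop 0] with n hn
    rw [Pi.div_apply, le_div_iff₀ (by positivity)]
    exact le_card_shortRunSets hn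
  · rw [Pi.div_apply, div_le_one (by positivity)]
    exact_mod_cast card_shortRunSets_le n

theorem eventually_nonempty_shortRunSets : ∀ᶠ n in atTop, (shortRunSets n).Nonempty := by
  filter_upwards [eventually_ge_atTop 3] with n hn
  have h1 := le_card_shortRunSets (n := n) (by omega)
  have hn' : (3 : ℝ) ≤ n := by exact_mod_cast hn
  have h2 : (2 / n : ℝ) < 1 := (div_lt_one (by linarith)).2 (by linarith)
  have h3 : (0 : ℝ) < (1 - 2 / n) * 2 ^ (n - 1) := mul_pos (by linarith) (by positivity)
  exact Finset.card_pos.1 (by exact_mod_cast h3.trans_le h1)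

open scoped Classical in
/-- The collection `shortRunSets n`, or the full power set in the finitely many cases in which
there are no sets with short runs. -/
noncomputable def goodSets (n : ℕ) : Finset (Finset ℕ) :=
  if (shortRunSets n).Nonempty then shortRunSets n else (Finset.Icc 1 (n - 1)).powerset

theorem goodSets_nonempty (n : ℕ) : (goodSets n).Nonempty := by
  unfold goodSets
  split_ifs with h
  · exact h
  · exact Finset.powerset_nonempty _

theorem goodSets_subset (n : ℕ) : goodSets n ⊆ (Finset.Icc 1 (n - 1)).powerset := by
  classical
  unfold goodSets
  split_ifs with h
  · exact Finset.filter_subset _ _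
  · exact subset_rfl

theorem eventually_goodSets_eq : ∀ᶠ n in atTop, goodSets n = shortRunSets n := by
  filter_upwards [eventually_nonempty_shortRunSets] with n hn
  exact if_pos hn

end Asymptotic

end CyclicDescent

open CyclicDescent in
theorem mainTheorem4 :
    ∃ (𝓘 : ℕ → Finset (Finset ℕ)) (h𝓘 : ∀ n, (𝓘 n).Nonempty),
      (∀ n, 𝓘 n ⊆ (Finset.Icc 1 (n - 1)).powerset) ∧
      (fun n => ((𝓘 n).card : ℝ)) ~[atTop] (fun n => (2 : ℝ) ^ (n - 1)) ∧
      Tendsto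
        (fun n => (𝓘 n).sup' (h𝓘 n) fun I =>
          |(n : ℝ) * (CyclicDescent.betaCyc n I : ℝ) / (CyclicDescent.beta n I : ℝ) - 1|)
        atTop (𝓝 0) := by
  refine ⟨goodSets, goodSets_nonempty, goodSets_subset, ?_, ?_⟩
  · refine isEquivalent_card_shortRunSets.congr_left ?_
    filter_upwards [eventually_goodSets_eq] with n hn
    rw [hn]
  · refine squeeze_zero' (Eventually.of_forall fun n => ?_) ?_ tendsto_runError
    · obtain ⟨I, hI⟩ := goodSets_nonempty n
      exact (abs_nonneg _).trans (Finset.le_sup' (fun I =>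
        |(n : ℝ) * (betaCyc n I : ℝ) / (beta n I : ℝ) - 1|) hI)
    · filter_upwards [eventually_goodSets_eq, eventually_ge_atTop 2,
        tendsto_runError.eventually_le_const one_pos] with n hn hn2 hn1
      refine Finset.sup'_le _ _ fun I hI => ?_
      rw [hn, mem_shortRunSets] at hI
      -- Once `runError n ≤ 1`, its `n`-th power is at most itself, so a bound tending to `0`
      -- suffices.
      exact (abs_ratio_sub_one_le hn2 hI.1 hI.2).trans
        (pow_le_of_le_one (runError_nonneg n) hn1 (by omega))
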